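/- Let $\Delta$ be a thick spherical building with Coxeter system $(W,I)$, regarded as a simplicial complex with apartments and with its type function; for $i\in I$ let $V_i$ be the set of vertices of type $i$, and let $C$ be the set of chambers, a chamber being viewed as an $I$-tuple of vertices, i.e. $C\subseteq\prod_{i\in I}V_i$. A \emph{compact topology} on $\Delta$ is a family of compact Hausdorff topologies on the sets $V_i$, $i\in I$, such that $C$ is closed in $\prod_{i\in I}V_i$; then $\Delta$ is called a \emph{compact spherical building}, and $C$ and all its subsets carry the subspace topology. For chambers $c,d$ the Weyl distance is $\delta(c,d)=i_1\cdots i_m\in W$, where $(i_1,\dots,i_m)$ is the type of a minimal gallery from $c$ to $d$. A \emph{panel} is the set of all chambers containing a given simplex of type $I\setminus\{j\}$, for some $j\in I$, and a \emph{punctured panel} is a panel with one chamber removed. (a) Let $\Delta$ be a compact spherical building, let $c_0\in C$, and let $w\in W$ have word length $\ell(w)=m\ge 1$. Then the Schubert cell $C_w(c_0)=\{c\in C : \delta(c_0,c)=w\}$ is homeomorphic to a product of $m$ punctured panels. (b) The topology of a compact spherical building is uniquely determined by its restriction to the panels: if two compact topologies on the same spherical building $\Delta$ induce the same topology on every panel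 of $\Delta$, then they coincide, i.e. they are the same topology on each $V_i$. -/

import Mathlib

/-- The special subgroup `W_J = ⟨J⟩` of a Coxeter system `(W, I)`. -/
def specialSubgroup {I : Type*} {M : CoxeterMatrix I} {W : Type*} [Group W]
    (cs : CoxeterSystem M W) (J : Set I) : Subgroup W :=
  Subgroup.closure (cs.simple '' J)

/-- The left coset `w W_J`. -/
def specialCoset {I : Type*} {M : CoxeterMatrix I} {W : Type*} [Group W]
    (cs : CoxeterSystem M W) (w : W) (J : Set I) : Set W :=
  (fun x => w * x) '' (specialSubgroup cs J : Set W)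

/-- The Coxeter complex `Σ(W, I) = ⋃ {W / W_J ; J ⊆ I}`, ordered by reversed inclusion. -/
abbrev CoxeterComplex {I : Type*} {M : CoxeterMatrix I} {W : Type*} [Group W]
    (cs : CoxeterSystem M W) : Type _ :=
  (↥{S : Set W | ∃ (w : W) (J : Set I), S = specialCoset cs w J})ᵒᵈ

/-- The type of a simplex `a` whose vertices lie in the disjoint union of the sets `V i`. -/
def simplexType {I : Type*} {V : I → Type*} (a : Finset (Σ i, V i)) : Set I :=
  Sigma.fst '' (a : Set (Σ i, V i))

/-- A set of simplices `A` is isomorphic, as a poset and with types, to the Coxeter complex.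
The simplex `w W_J` of the Coxeter complex has type `I \ J`; so a simplex of type `K` has to go
to a coset of `W_{I \ K}`. -/
def IsoCoxeterComplex {I : Type*} {M : CoxeterMatrix I} {W : Type*} [Group W]
    (cs : CoxeterSystem M W) {V : I → Type*} (A : Set (Finset (Σ i, V i))) : Prop :=
  ∃ e : ↥A ≃o CoxeterComplex cs,
    ∀ a : ↥A, ∃ w : W, (OrderDual.ofDual (e a)).1 = specialCoset cs w (simplexType a.1)ᶜ

/-- A thick building with Coxeter system `(W, I)`, as a simplicial complex with apartments;
`V i` is the set of its vertices of type `i`, and `faces` is the set of its simplices, the empty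
simplex included. -/
structure ThickBuilding {I : Type*} {M : CoxeterMatrix I} {W : Type*} [Group W]
    (cs : CoxeterSystem M W) (V : I → Type*) where
  faces : Set (Finset (Σ i, V i))
  empty_mem : ∅ ∈ faces
  singleton_mem : ∀ v : Σ i, V i, {v} ∈ faces
  down_closed : ∀ a b : Finset (Σ i, V i), a ⊆ b → b ∈ faces → a ∈ faces
  apartments : Set (Set (Finset (Σ i, V i)))
  apartment_subset : ∀ A ∈ apartments, A ⊆ faces
  apartment_down_closed : ∀ A ∈ apartments,
    ∀ a b : Finset (Σ i, V i), a ⊆ b → b ∈ A → a ∈ A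
  apartment_iso : ∀ A ∈ apartments, IsoCoxeterComplex cs A
  /-- Any two simplices lie in a common apartment. -/
  exists_apartment : ∀ a ∈ faces, ∀ b ∈ faces, ∃ A ∈ apartments, a ∈ A ∧ b ∈ A
  /-- If two apartments contain the simplices `a` and `b`, then there is a type preserving
  isomorphism between them that fixes `a` and `b`. -/
  exists_iso : ∀ A ∈ apartments, ∀ A' ∈ apartments,
    ∀ a b : Finset (Σ i, V i), a ∈ A → b ∈ A → a ∈ A' → b ∈ A' →
      ∃ f : ↥A ≃o ↥A', (∀ x : ↥A, simplexType (f x).1 = simplexType x.1) ∧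
        (∀ x : ↥A, x.1 = a → (f x).1 = a) ∧ (∀ x : ↥A, x.1 = b → (f x).1 = b)
  /-- Every non-maximal simplex is contained in at least three maximal simplices. -/
  thick : ∀ a ∈ faces, ¬ Maximal (· ∈ faces) a →
    3 ≤ Set.encard {c | Maximal (· ∈ faces) c ∧ a ⊆ c}

namespace ThickBuilding

theorem specialCoset_eq_of_mem {I : Type*} {M : CoxeterMatrix I} {W : Type*} [Group W]
    {cs : CoxeterSystem M W} {w x : W} {J : Set I} (h : x ∈ specialCoset cs w J) :
    specialCoset cs w J = specialCoset cs x J := by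
  obtain ⟨g, hg, rfl⟩ := h
  ext y
  constructor
  · rintro ⟨k, hk, rfl⟩
    exact ⟨g⁻¹ * k, mul_mem (inv_mem hg) hk, by simp [mul_assoc]⟩
  · rintro ⟨k, hk, rfl⟩
    exact ⟨g * k, mul_mem hg hk, by simp [mul_assoc]⟩

/-- Distinct vertices of a simplex have distinct types. -/
theorem eq_of_mem_face {I : Type*} {M : CoxeterMatrix I} {W : Type*} [Group W]
    {cs : CoxeterSystem M W} {V : I → Type*}
    (Δ : ThickBuilding cs V) {a : Finset (Σ i, V i)} (ha : a ∈ Δ.faces)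
    {u v : Σ i, V i} (hu : u ∈ a) (hv : v ∈ a) (huv : u.1 = v.1) : u = v := by
  obtain ⟨A, hA, haA, -⟩ := Δ.exists_apartment a ha a ha
  have hua : ({u} : Finset (Σ i, V i)) ⊆ a := Finset.singleton_subset_iff.2 hu
  have hva : ({v} : Finset (Σ i, V i)) ⊆ a := Finset.singleton_subset_iff.2 hv
  have huA := Δ.apartment_down_closed A hA _ _ hua haA
  have hvA := Δ.apartment_down_closed A hA _ _ hva haA
  obtain ⟨e, he⟩ := Δ.apartment_iso A hA
  obtain ⟨w, hw⟩ := he ⟨a, haA⟩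
  obtain ⟨w₁, h₁⟩ := he ⟨{u}, huA⟩
  obtain ⟨w₂, h₂⟩ := he ⟨{v}, hvA⟩
  have hwa : w ∈ (OrderDual.ofDual (e ⟨a, haA⟩)).1 := by
    rw [hw]; exact ⟨1, one_mem _, by simp⟩
  have le₁ : e ⟨{u}, huA⟩ ≤ e ⟨a, haA⟩ := e.monotone hua
  have le₂ : e ⟨{v}, hvA⟩ ≤ e ⟨a, haA⟩ := e.monotone hva
  have m₁ : w ∈ (OrderDual.ofDual (e ⟨{u}, huA⟩)).1 := le₁ hwa
  have m₂ : w ∈ (OrderDual.ofDual (e ⟨{v}, hvA⟩)).1 := le₂ hwa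
  rw [h₁] at m₁
  rw [h₂] at m₂
  have key : e ⟨{u}, huA⟩ = e ⟨{v}, hvA⟩ := by
    apply OrderDual.ofDual.injective
    apply Subtype.ext
    rw [h₁, h₂, specialCoset_eq_of_mem m₁, specialCoset_eq_of_mem m₂]
    simp [simplexType, huv]
  have := congrArg Subtype.val (e.injective key)
  simpa using this

section

variable {I : Type*} [Fintype I] {M : CoxeterMatrix I} {W : Type*} [Group W]
  {cs : CoxeterSystem M W} {V : I → Type*}

/-- A building is spherical if its apartments are finite. -/
def IsSpherical (Δ : ThickBuilding cs V) : Prop :=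
  ∀ A ∈ Δ.apartments, A.Finite

/-- The set of vertices of an `I`-tuple of vertices. -/
def tupleVertices (x : ∀ i, V i) : Finset (Σ i, V i) :=
  Finset.univ.map ⟨fun i => ⟨i, x i⟩, fun _ _ h => congrArg Sigma.fst h⟩

/-- The set of chambers (maximal simplices), viewed as `I`-tuples of vertices; see
`maximal_eq_tupleVertices` below: every maximal simplex is of this form. -/
def chambers (Δ : ThickBuilding cs V) : Set (∀ i, V i) :=
  {x | Maximal (· ∈ Δ.faces) (tupleVertices x)}

/-- The chambers `c` and `d` have a common simplex of type `I \ {i}`. -/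
def Adjacent (Δ : ThickBuilding cs V) (i : I) (c d : ↥Δ.chambers) : Prop :=
  ∃ a ∈ Δ.faces, simplexType a = {i}ᶜ ∧ a ⊆ tupleVertices c.1 ∧ a ⊆ tupleVertices d.1

/-- There is a (possibly stammering) gallery of the given type from the first chamber to the
second one. -/
inductive Gallery (Δ : ThickBuilding cs V) : List I → ↥Δ.chambers → ↥Δ.chambers → Prop
  | nil (c : ↥Δ.chambers) : Gallery Δ [] c c
  | cons {i : I} {ω : List I} {c d e : ↥Δ.chambers} :
      Δ.Adjacent i c d → Gallery Δ ω d e → Gallery Δ (i :: ω) c e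

/-- The Weyl distance `δ(c, d)` equals `w`: there is a minimal gallery from `c` to `d` of some
type `(i₁, …, iₘ)` with `w = i₁ ⋯ iₘ`. -/
def HasWeylDist (Δ : ThickBuilding cs V) (c d : ↥Δ.chambers) (w : W) : Prop :=
  ∃ ω : List I, Δ.Gallery ω c d ∧ (∀ ω' : List I, Δ.Gallery ω' c d → ω.length ≤ ω'.length) ∧
    cs.wordProd ω = w

/-- The Schubert cell `C_w(c₀)`. -/
def schubertCell (Δ : ThickBuilding cs V) (c₀ : ↥Δ.chambers) (w : W) : Set ↥Δ.chambers :=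
  {c | Δ.HasWeylDist c₀ c w}

/-- A set of chambers is a panel: it consists of all chambers that contain some fixed simplex of
type `I \ {j}`. -/
def IsPanel (Δ : ThickBuilding cs V) (P : Set ↥Δ.chambers) : Prop :=
  ∃ (j : I), ∃ a ∈ Δ.faces, simplexType a = {j}ᶜ ∧ P = {c | a ⊆ tupleVertices c.1}

/-- Topologies on the sets `V i` that make the (spherical) building a compact building. -/
structure IsCompactTopology (Δ : ThickBuilding cs V) (T : ∀ i, TopologicalSpace (V i)) :
    Prop where
  compact : ∀ i, @CompactSpace (V i) (T i)
  hausdorff : ∀ i, @T2Space (V i) (T i)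
  isClosed_chambers : @IsClosed (∀ i, V i) (@Pi.topologicalSpace I V T) Δ.chambers

/-- The topology on the set of chambers, as a subspace of the product of the sets `V i`. -/
abbrev chamberTopology (Δ : ThickBuilding cs V) (T : ∀ i, TopologicalSpace (V i)) :
    TopologicalSpace ↥Δ.chambers :=
  TopologicalSpace.induced Subtype.val (@Pi.topologicalSpace I V T)

/-- The subspace topology on a set of chambers. -/
abbrev setTopology (Δ : ThickBuilding cs V) (T : ∀ i, TopologicalSpace (V i))
    (P : Set ↥Δ.chambers) : TopologicalSpace ↥P :=
  TopologicalSpace.induced Subtype.val (Δ.chamberTopology T)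

/-- Every maximal simplex has exactly one vertex of each type. -/
theorem maximal_eq_tupleVertices (Δ : ThickBuilding cs V) {a : Finset (Σ i, V i)}
    (ha : Maximal (· ∈ Δ.faces) a) : ∃ x ∈ Δ.chambers, a = tupleVertices x := by
  obtain ⟨A, hA, haA, -⟩ := Δ.exists_apartment a ha.1 a ha.1
  obtain ⟨e, he⟩ := Δ.apartment_iso A hA
  obtain ⟨w, hw⟩ := he ⟨a, haA⟩
  have hwa : w ∈ specialCoset cs w (simplexType a)ᶜ := ⟨1, one_mem _, by simp⟩
  obtain ⟨b, hb⟩ := e.surjective (OrderDual.toDual ⟨{w}, w, ∅, by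
    simp [specialCoset, specialSubgroup]⟩)
  have hab : (⟨a, haA⟩ : ↥A) ≤ b := by
    rw [← e.le_iff_le, hb]
    change ({w} : Set W) ⊆ (OrderDual.ofDual (e ⟨a, haA⟩)).1
    rw [hw]
    simpa using hwa
  have hba : b = ⟨a, haA⟩ :=
    le_antisymm (ha.2 (Δ.apartment_subset A hA b.2) hab) hab
  have hsing : specialCoset cs w (simplexType a)ᶜ = {w} := by
    rw [← hw, ← hba, hb]; rfl
  have htype : ∀ i, i ∈ simplexType a := by
    intro i
    by_contra hi
    have : w * cs.simple i ∈ specialCoset cs w (simplexType a)ᶜ :=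
      ⟨cs.simple i, Subgroup.subset_closure ⟨i, hi, rfl⟩, rfl⟩
    rw [hsing] at this
    have h1 : cs.simple i = 1 := by simpa using this
    have h2 := cs.length_simple i
    rw [h1, cs.length_one] at h2
    exact zero_ne_one h2
  have hx : ∀ i, ∃ v : V i, (⟨i, v⟩ : Σ i, V i) ∈ a := by
    intro i
    obtain ⟨⟨j, v⟩, hv, rfl⟩ := htype i
    exact ⟨v, hv⟩
  choose x hx using hx
  have hax : a = tupleVertices x := by
    ext v
    simp only [tupleVertices, Finset.mem_map, Finset.mem_univ, true_and]
    constructor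
    · intro hv
      exact ⟨v.1, Δ.eq_of_mem_face ha.1 (hx v.1) hv rfl⟩
    · rintro ⟨i, rfl⟩
      exact hx i
  exact ⟨x, by rw [chambers, Set.mem_ofPred_eq, ← hax]; exact ha, hax⟩

end

end ThickBuilding

/-!
Both claims rest on a bijection between a Schubert cell and a product of punctured panels that
involves no topology and is a homeomorphism for every compact topology
(`ThickBuilding.IsSpherical.exists_schubertCell_equiv`).

The combinatorial side is the theory of the Weyl distance `δ`. Every apartment is parametrized by
`W` (`IsChart`), and two charts based at the same chamber agree on the intersection of their
apartments (`IsChart.subset_of_subset`). So `δ` may be read off in charts, and passing from `d` to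
an `i`-adjacent chamber either fixes `δ(c, d)` or multiplies it by `s_i`
(`Adjacent.weylDist_right`). If `δ(c, d) s_i` is longer than `δ(c, d)`, then the second case
holds for all chambers of the panel other than `d` (`Adjacent.weylDist_eq_mul`): every panel has a
unique chamber closest to `c`, the projection of `c`. Thickness yields Tits's folding condition for
`W` (`length_simple_mul_mul_simple`), hence the longest element `v` of the finite group `W`, for
which `ℓ(x) + ℓ(x⁻¹ v) = ℓ(v)`, and conjugation by which permutes the generators.

For the topological side, the pairs of chambers at distance of length at most `n` form a closed set
(`isClosed_setOf_length_weylDist_le`). Hence the graph of a projection to panels is closed as long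
as the Weyl distance is constant, and since the set of chambers is compact, such projections are
continuous (`IsCompactTopology.continuous_projection`).

If `w = u s_i` is longer than `u`, choose a chamber `e` with `δ(e, c₀) = v w⁻¹`. It is opposite (at distance `v`) to
all chambers of `C_w(c₀)`, and with `s_j v = v s_i` the `j`-panel of `e` is opposite to the
`i`-panel of every chamber of `C_u(c₀)`. Projecting to these panels in both directions identifies
`C_w(c₀)` with the product of the punctured `j`-panel of `e` and `C_u(c₀)`; induction on the length
of `w` gives the product decomposition.

For the uniqueness of the topology, the cells `C_v(c₀)` of the longest element are open for every
compact topology and cover the set of chambers, and their topologies are determined by those of the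
panels. So the topology of the set of chambers is determined, and the set of vertices of type `i`
is a quotient space of it, being the image of a compact space in a Hausdorff space.
-/

namespace ThickBuilding

/-! ### Cosets of special subgroups -/

section

variable {I : Type*} {M : CoxeterMatrix I} {W : Type*} [Group W] {cs : CoxeterSystem M W}

theorem specialSubgroup_empty : specialSubgroup cs (∅ : Set I) = ⊥ := by
  simp [specialSubgroup]

theorem self_mem_specialCoset (w : W) (J : Set I) : w ∈ specialCoset cs w J :=
  ⟨1, one_mem _, mul_one w⟩

theorem specialCoset_empty (w : W) : specialCoset cs w (∅ : Set I) = {w} := by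
  simp [specialCoset, specialSubgroup_empty]

theorem specialCoset_singleton (w : W) (i : I) :
    specialCoset cs w {i} = {w, w * cs.simple i} := by
  have h : ∀ g, g ∈ specialSubgroup cs ({i} : Set I) ↔ g = 1 ∨ g = cs.simple i := by
    intro g
    rw [specialSubgroup, Set.image_singleton]
    constructor
    · intro hg
      induction hg using Subgroup.closure_induction with
      | mem x hx => exact Or.inr hx
      | one => exact Or.inl rfl
      | mul x y _ _ hx hy =>
        rcases hx with rfl | rfl <;> rcases hy with rfl | rfl <;> simp
      | inv x _ hx => rcases hx with rfl | rfl <;> simp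
    · rintro (rfl | rfl)
      · exact one_mem _
      · exact Subgroup.subset_closure rfl
  ext x
  simp only [specialCoset, Set.mem_image, SetLike.mem_coe, h]
  aesop

end

section

variable {I : Type*} [Fintype I] {M : CoxeterMatrix I} {W : Type*} [Group W]
  {cs : CoxeterSystem M W} {V : I → Type*}

/-! ### Faces of chambers -/

theorem mem_tupleVertices {x : ∀ i, V i} {v : Σ i, V i} :
    v ∈ tupleVertices x ↔ x v.1 = v.2 := by
  obtain ⟨j, v⟩ := v
  simp only [tupleVertices, Finset.mem_map, Finset.mem_univ, true_and]
  constructor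
  · rintro ⟨i, h⟩
    obtain ⟨rfl, h⟩ := Sigma.mk.inj_iff.1 h
    exact eq_of_heq h
  · rintro rfl
    exact ⟨j, rfl⟩

theorem tupleVertices_injective :
    Function.Injective (tupleVertices : (∀ i, V i) → Finset (Σ i, V i)) := by
  intro x y h
  funext i
  have : (⟨i, x i⟩ : Σ i, V i) ∈ tupleVertices y := h ▸ mem_tupleVertices.2 rfl
  exact (mem_tupleVertices.1 this).symm

theorem simplexType_tupleVertices (x : ∀ i, V i) :
    simplexType (tupleVertices x) = Set.univ :=
  Set.eq_univ_of_forall fun i => ⟨⟨i, x i⟩, mem_tupleVertices.2 rfl, rfl⟩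

/-- The face of type `I \ {i}` of the simplex spanned by an `I`-tuple of vertices. -/
noncomputable def panelFace (x : ∀ i, V i) (i : I) : Finset (Σ i, V i) := by
  classical exact (tupleVertices x).filter fun v => v.1 ≠ i

theorem panelFace_subset (x : ∀ i, V i) (i : I) : panelFace x i ⊆ tupleVertices x := by
  classical exact Finset.filter_subset _ _

theorem mem_panelFace {x : ∀ i, V i} {i : I} {v : Σ i, V i} :
    v ∈ panelFace x i ↔ x v.1 = v.2 ∧ v.1 ≠ i := by
  simp [panelFace, mem_tupleVertices]

theorem simplexType_panelFace (x : ∀ i, V i) (i : I) : simplexType (panelFace x i) = {i}ᶜ := by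
  ext j
  constructor
  · rintro ⟨v, hv, rfl⟩
    exact (mem_panelFace.1 hv).2
  · intro hj
    exact ⟨⟨j, x j⟩, mem_panelFace.2 ⟨rfl, hj⟩, rfl⟩

theorem panelFace_subset_iff {x y : ∀ i, V i} {i : I} :
    panelFace x i ⊆ tupleVertices y ↔ ∀ j, j ≠ i → x j = y j := by
  constructor
  · intro h j hj
    exact (mem_tupleVertices.1 (h (mem_panelFace.2 ⟨rfl, hj⟩ : (⟨j, x j⟩ : Σ i, V i) ∈ _))).symm
  · intro h v hv
    obtain ⟨h1, h2⟩ := mem_panelFace.1 hv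
    exact mem_tupleVertices.2 ((h _ h2).symm.trans h1)

theorem eq_panelFace {x : ∀ i, V i} {i : I} {a : Finset (Σ i, V i)}
    (h : a ⊆ tupleVertices x) (ha : simplexType a = {i}ᶜ) : a = panelFace x i := by
  ext v
  rw [mem_panelFace]
  constructor
  · intro hv
    refine ⟨mem_tupleVertices.1 (h hv), ?_⟩
    have : v.1 ∈ simplexType a := ⟨v, hv, rfl⟩
    rwa [ha] at this
  · rintro ⟨h1, h2⟩
    have : v.1 ∈ simplexType a := by rw [ha]; exact h2
    obtain ⟨u, hu, huv⟩ := this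
    have h3 := mem_tupleVertices.1 (h hu)
    obtain ⟨j, u⟩ := u
    obtain ⟨k, v⟩ := v
    obtain rfl : j = k := huv
    obtain rfl : u = v := h3.symm.trans h1
    exact hu

variable (Δ : ThickBuilding cs V)

theorem panelFace_mem_faces (c : ↥Δ.chambers) (i : I) : panelFace c.1 i ∈ Δ.faces :=
  Δ.down_closed _ _ (panelFace_subset _ _) c.2.1

variable {Δ}

theorem adjacent_iff {i : I} {c d : ↥Δ.chambers} :
    Δ.Adjacent i c d ↔ ∀ j, j ≠ i → c.1 j = d.1 j := by
  rw [← panelFace_subset_iff]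
  constructor
  · rintro ⟨a, -, ht, hc, hd⟩
    rwa [← eq_panelFace hc ht]
  · intro h
    exact ⟨_, Δ.panelFace_mem_faces c i, simplexType_panelFace _ _, panelFace_subset _ _, h⟩

theorem Adjacent.refl (i : I) (c : ↥Δ.chambers) : Δ.Adjacent i c c :=
  adjacent_iff.2 fun _ _ => rfl

theorem Adjacent.symm {i : I} {c d : ↥Δ.chambers} (h : Δ.Adjacent i c d) : Δ.Adjacent i d c :=
  adjacent_iff.2 fun j hj => (adjacent_iff.1 h j hj).symm

theorem Adjacent.trans {i : I} {c d e : ↥Δ.chambers} (h : Δ.Adjacent i c d)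
    (h' : Δ.Adjacent i d e) : Δ.Adjacent i c e :=
  adjacent_iff.2 fun j hj => (adjacent_iff.1 h j hj).trans (adjacent_iff.1 h' j hj)

theorem isPanel_setOf_adjacent (i : I) (c : ↥Δ.chambers) : Δ.IsPanel {d | Δ.Adjacent i c d} := by
  refine ⟨i, _, Δ.panelFace_mem_faces c i, simplexType_panelFace _ _, ?_⟩
  ext d
  rw [Set.mem_ofPred_eq, Set.mem_ofPred_eq, adjacent_iff, panelFace_subset_iff]

/-- Thickness, in the form in which it is used. -/
theorem exists_third_chamber (i : I) (c d : ↥Δ.chambers) :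
    ∃ e, Δ.Adjacent i c e ∧ e ≠ c ∧ e ≠ d := by
  have hn : ¬ Maximal (· ∈ Δ.faces) (panelFace c.1 i) := by
    intro h
    have h1 := h.2 c.2.1 (panelFace_subset c.1 i)
    have h2 : (⟨i, c.1 i⟩ : Σ i, V i) ∈ panelFace c.1 i := h1 (mem_tupleVertices.2 rfl)
    exact (mem_panelFace.1 h2).2 rfl
  have h3 := Δ.thick _ (Δ.panelFace_mem_faces c i) hn
  by_contra! hcon
  have hsub : {b | Maximal (· ∈ Δ.faces) b ∧ panelFace c.1 i ⊆ b} ⊆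
      {tupleVertices c.1, tupleVertices d.1} := by
    rintro b ⟨hb, hcb⟩
    obtain ⟨x, hx, rfl⟩ := Δ.maximal_eq_tupleVertices hb
    by_cases hxc : (⟨x, hx⟩ : ↥Δ.chambers) = c
    · left; rw [← hxc]
    · right
      have := hcon ⟨x, hx⟩ (adjacent_iff.2 (panelFace_subset_iff.1 hcb)) hxc
      rw [← this]; rfl
  have h4 := (h3.trans (Set.encard_le_encard hsub)).trans (Set.encard_insert_le _ _)
  rw [Set.encard_singleton] at h4
  exact absurd h4 (by decide)

variable (Δ) in
theorem exists_eq_tupleVertices {a : Finset (Σ i, V i)} (ha : a ∈ Δ.faces)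
    (ht : simplexType a = Set.univ) : ∃ c : ↥Δ.chambers, a = tupleVertices c.1 := by
  have hmax : Maximal (· ∈ Δ.faces) a := by
    refine ⟨ha, fun b hb hab v hv => ?_⟩
    have : v.1 ∈ simplexType a := ht ▸ Set.mem_univ _
    obtain ⟨u, hu, huv⟩ := this
    rwa [← Δ.eq_of_mem_face hb (hab hu) hv huv]
  obtain ⟨x, hx, h⟩ := Δ.maximal_eq_tupleVertices hmax
  exact ⟨⟨x, hx⟩, h⟩

/-! ### Charts of apartments -/

/-- A parametrization of the chambers of the apartment `A` by `W`, such that chambers are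
`i`-adjacent if and only if their parameters agree up to right multiplication by the
generator `i`. -/
structure IsChart (Δ : ThickBuilding cs V) (A : Set (Finset (Σ i, V i))) (φ : W → ↥Δ.chambers) :
    Prop where
  apartment : A ∈ Δ.apartments
  mem : ∀ w, tupleVertices (φ w).1 ∈ A
  surj : ∀ c : ↥Δ.chambers, tupleVertices c.1 ∈ A → ∃ w, φ w = c
  inj : Function.Injective φ
  adjacent : ∀ w w' i, Δ.Adjacent i (φ w) (φ w') ↔ w' = w ∨ w' = w * cs.simple i
  exists_ge : ∀ a ∈ A, ∃ w, a ⊆ tupleVertices (φ w).1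

theorem exists_isChart {A : Set (Finset (Σ i, V i))} (hA : A ∈ Δ.apartments) :
    ∃ φ, Δ.IsChart A φ := by
  obtain ⟨e, he⟩ := Δ.apartment_iso A hA
  let q : W → CoxeterComplex cs := fun w =>
    OrderDual.toDual ⟨{w}, w, ∅, (specialCoset_empty w).symm⟩
  have le_q : ∀ (a : ↥A) w, a ≤ e.symm (q w) ↔ w ∈ (OrderDual.ofDual (e a)).1 := by
    intro a w
    rw [← e.le_iff_le, e.apply_symm_apply]
    exact Set.singleton_subset_iff
  have coset_eq : ∀ (a : ↥A) w, w ∈ (OrderDual.ofDual (e a)).1 →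
      (OrderDual.ofDual (e a)).1 = specialCoset cs w (simplexType a.1)ᶜ := by
    intro a w hw
    obtain ⟨u, hu⟩ := he a
    rw [hu] at hw ⊢
    exact specialCoset_eq_of_mem hw
  have htop : ∀ w, simplexType (e.symm (q w)).1 = Set.univ := by
    intro w
    refine Set.eq_univ_of_forall fun i => ?_
    by_contra hi
    have h1 := coset_eq (e.symm (q w)) w ((le_q _ _).1 le_rfl)
    rw [e.apply_symm_apply] at h1
    have h2 : w * cs.simple i ∈ ({w} : Set W) := by
      change ({w} : Set W) = _ at h1
      rw [h1]
      exact ⟨cs.simple i, Subgroup.subset_closure ⟨i, hi, rfl⟩, rfl⟩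
    have h3 : cs.simple i = 1 := by simpa using h2
    have h4 := cs.length_simple i
    rw [h3, cs.length_one] at h4
    exact zero_ne_one h4
  choose φ hφ using fun w => Δ.exists_eq_tupleVertices
    (Δ.apartment_subset A hA (e.symm (q w)).2) (htop w)
  have hmem : ∀ w, tupleVertices (φ w).1 ∈ A := fun w => by rw [← hφ]; exact (e.symm (q w)).2
  have le_iff : ∀ (a : ↥A) w, a.1 ⊆ tupleVertices (φ w).1 ↔ w ∈ (OrderDual.ofDual (e a)).1 := by
    intro a w
    rw [← hφ, ← le_q]; rfl
  refine ⟨φ, hA, hmem, ?_, ?_, ?_, ?_⟩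
  · intro c hc
    obtain ⟨w, hw⟩ := he ⟨_, hc⟩
    rw [simplexType_tupleVertices, Set.compl_univ, specialCoset_empty] at hw
    refine ⟨w, ?_⟩
    have h1 : e ⟨_, hc⟩ = q w := OrderDual.ofDual.injective (Subtype.ext hw)
    have h2 := hφ w
    rw [← h1, e.symm_apply_apply] at h2
    exact Subtype.ext (tupleVertices_injective h2.symm)
  · intro w w' h
    have h1 : e.symm (q w) = e.symm (q w') := by
      apply Subtype.ext; rw [hφ, hφ, h]
    have h2 := e.symm.injective h1
    have h3 : ({w} : Set W) = {w'} := congrArg (fun x => (OrderDual.ofDual x).1) h2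
    exact Set.singleton_injective h3
  · intro w w' i
    have hb : panelFace (φ w).1 i ∈ A :=
      Δ.apartment_down_closed A hA _ _ (panelFace_subset _ _) (hmem w)
    have h1 := coset_eq ⟨_, hb⟩ w ((le_iff _ _).1 (panelFace_subset _ _))
    rw [simplexType_panelFace, compl_compl, specialCoset_singleton] at h1
    rw [adjacent_iff, ← panelFace_subset_iff, le_iff ⟨_, hb⟩, h1]
    rfl
  · intro a ha
    obtain ⟨w, hw⟩ := he ⟨a, ha⟩
    exact ⟨w, (le_iff ⟨a, ha⟩ w).2 (hw ▸ self_mem_specialCoset _ _)⟩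

theorem IsChart.translate {A : Set (Finset (Σ i, V i))} {φ : W → ↥Δ.chambers}
    (h : Δ.IsChart A φ) (g : W) : Δ.IsChart A fun w => φ (g * w) where
  apartment := h.apartment
  mem w := h.mem _
  surj c hc := by
    obtain ⟨w, hw⟩ := h.surj c hc
    exact ⟨g⁻¹ * w, by simpa using hw⟩
  inj := h.inj.comp (mul_right_injective g)
  adjacent w w' i := by
    rw [h.adjacent, mul_assoc, mul_left_cancel_iff, mul_left_cancel_iff]
  exists_ge a ha := by
    obtain ⟨w, hw⟩ := h.exists_ge a ha
    exact ⟨g⁻¹ * w, by simpa using hw⟩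

/-- An isomorphism of apartments that fixes a chamber respects the charts based at that chamber,
because it preserves adjacency; as it may be chosen to fix a given second simplex as well, the two
charts agree on every common simplex. -/
theorem IsChart.subset_of_subset {A A' : Set (Finset (Σ i, V i))} {φ ψ : W → ↥Δ.chambers}
    (hφ : Δ.IsChart A φ) (hψ : Δ.IsChart A' ψ) (h1 : φ 1 = ψ 1) {x : W} {b : Finset (Σ i, V i)}
    (hbA : b ∈ A) (hbA' : b ∈ A') (hb : b ⊆ tupleVertices (φ x).1) :
    b ⊆ tupleVertices (ψ x).1 := by
  obtain ⟨f, hft, hfa, hfb⟩ := Δ.exists_iso A hφ.apartment A' hψ.apartment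
    (tupleVertices (φ 1).1) b (hφ.mem 1) hbA (h1 ▸ hψ.mem 1) hbA'
  have hσ : ∀ w, ∃ w', (f ⟨_, hφ.mem w⟩).1 = tupleVertices (ψ w').1 := by
    intro w
    have ht := hft ⟨_, hφ.mem w⟩
    rw [simplexType_tupleVertices] at ht
    have hm := (f ⟨_, hφ.mem w⟩).2
    obtain ⟨c, hc⟩ := Δ.exists_eq_tupleVertices (Δ.apartment_subset A' hψ.apartment hm) ht
    rw [hc] at hm
    obtain ⟨w', rfl⟩ := hψ.surj c hm
    exact ⟨w', hc⟩
  choose σ hσ using hσ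
  have hinj : Function.Injective σ := by
    intro w w' hw
    have : f ⟨_, hφ.mem w⟩ = f ⟨_, hφ.mem w'⟩ := Subtype.ext (by rw [hσ, hσ, hw])
    exact hφ.inj (Subtype.ext (tupleVertices_injective (congrArg Subtype.val (f.injective this))))
  have hσ1 : σ 1 = 1 := by
    have h2 := hfa ⟨_, hφ.mem 1⟩ rfl
    rw [hσ, h1] at h2
    exact hψ.inj (Subtype.ext (tupleVertices_injective h2))
  have hσs : ∀ w j, σ (w * cs.simple j) = σ w * cs.simple j := by
    intro w j
    have hb : panelFace (φ w).1 j ∈ A :=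
      Δ.apartment_down_closed A hφ.apartment _ _ (panelFace_subset _ _) (hφ.mem w)
    have hb' : panelFace (φ w).1 j ⊆ tupleVertices (φ (w * cs.simple j)).1 :=
      panelFace_subset_iff.2 (adjacent_iff.1 ((hφ.adjacent _ _ _).2 (Or.inr rfl)))
    have h2 : (f ⟨_, hb⟩).1 ⊆ tupleVertices (ψ (σ w)).1 := by
      rw [← hσ]
      exact f.monotone (a := ⟨_, hb⟩) (b := ⟨_, hφ.mem w⟩) (panelFace_subset _ _)
    have h3 : (f ⟨_, hb⟩).1 ⊆ tupleVertices (ψ (σ (w * cs.simple j))).1 := by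
      rw [← hσ]
      exact f.monotone (a := ⟨_, hb⟩) (b := ⟨_, hφ.mem _⟩) hb'
    have h4 : Δ.Adjacent j (ψ (σ w)) (ψ (σ (w * cs.simple j))) :=
      ⟨_, Δ.apartment_subset A' hψ.apartment (f ⟨_, hb⟩).2,
        (hft _).trans (simplexType_panelFace _ _), h2, h3⟩
    refine ((hψ.adjacent _ _ _).1 h4).resolve_left fun h5 => ?_
    have h6 : cs.simple j = 1 := by simpa using hinj h5
    have h7 := cs.length_simple j
    rw [h6, cs.length_one] at h7
    exact zero_ne_one h7
  have hid : ∀ w, σ w = w := by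
    intro w
    induction w using cs.simple_induction_right with
    | one => exact hσ1
    | mul_simple_right w j hw => rw [hσs, hw]
  have h8 : (f ⟨b, hbA⟩).1 ⊆ (f ⟨_, hφ.mem x⟩).1 :=
    f.monotone (a := ⟨b, hbA⟩) (b := ⟨_, hφ.mem x⟩) hb
  rwa [hfb ⟨b, hbA⟩ rfl, hσ, hid] at h8

theorem IsChart.eq_or_eq_of_adjacent {A A' : Set (Finset (Σ i, V i))} {φ ψ : W → ↥Δ.chambers}
    (hφ : Δ.IsChart A φ) (hψ : Δ.IsChart A' ψ) (h1 : φ 1 = ψ 1) {x y : W} {i : I}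
    (h : Δ.Adjacent i (φ x) (ψ y)) : y = x ∨ y = x * cs.simple i := by
  have hsub : panelFace (φ x).1 i ⊆ tupleVertices (ψ x).1 :=
    hφ.subset_of_subset hψ h1
      (Δ.apartment_down_closed A hφ.apartment _ _ (panelFace_subset _ _) (hφ.mem x))
      (Δ.apartment_down_closed A' hψ.apartment _ _
        (panelFace_subset_iff.2 (adjacent_iff.1 h)) (hψ.mem y)) (panelFace_subset _ _)
  have hadj : Δ.Adjacent i (φ x) (ψ x) := adjacent_iff.2 (panelFace_subset_iff.1 hsub)
  exact (hψ.adjacent _ _ _).1 (hadj.symm.trans h)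

theorem eq_of_tupleVertices_subset {c d : ↥Δ.chambers}
    (h : tupleVertices c.1 ⊆ tupleVertices d.1) : c = d :=
  Subtype.ext (funext fun i =>
    (mem_tupleVertices.1 (h (mem_tupleVertices.2 rfl : (⟨i, c.1 i⟩ : Σ i, V i) ∈ _))).symm)

theorem IsChart.eq_of_eq {A A' : Set (Finset (Σ i, V i))} {φ ψ : W → ↥Δ.chambers}
    (hφ : Δ.IsChart A φ) (hψ : Δ.IsChart A' ψ) (h1 : φ 1 = ψ 1) {x y : W}
    (h : φ x = ψ y) : x = y := by
  have hsub := hφ.subset_of_subset hψ h1 (hφ.mem x) (h ▸ hψ.mem y) subset_rfl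
  exact hψ.inj ((eq_of_tupleVertices_subset hsub).symm.trans h)

theorem exists_chart (Δ : ThickBuilding cs V) (c d : ↥Δ.chambers) :
    ∃ A φ, Δ.IsChart A φ ∧ φ 1 = c ∧ ∃ w, φ w = d := by
  obtain ⟨A, hA, hc, hd⟩ := Δ.exists_apartment _ c.2.1 _ d.2.1
  obtain ⟨φ, hφ⟩ := exists_isChart hA
  obtain ⟨w, hw⟩ := hφ.surj c hc
  obtain ⟨w', hw'⟩ := hφ.surj d hd
  exact ⟨A, _, hφ.translate w, by simpa using hw, w⁻¹ * w', by simpa using hw'⟩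

end

section

variable {I : Type*} [Fintype I] {M : CoxeterMatrix I} {W : Type*} [Group W]
  {cs : CoxeterSystem M W} {V : I → Type*} {Δ : ThickBuilding cs V}

/-! ### The Weyl distance -/

/-- The Weyl distance of two chambers, read off in a chart that is based at the first one. -/
noncomputable def weylDist (Δ : ThickBuilding cs V) (c d : ↥Δ.chambers) : W :=
  (Δ.exists_chart c d).choose_spec.choose_spec.2.2.choose

theorem exists_chart_weylDist (c d : ↥Δ.chambers) :
    ∃ A φ, Δ.IsChart A φ ∧ φ 1 = c ∧ φ (Δ.weylDist c d) = d :=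
  ⟨_, _, (Δ.exists_chart c d).choose_spec.choose_spec.1,
    (Δ.exists_chart c d).choose_spec.choose_spec.2.1,
    (Δ.exists_chart c d).choose_spec.choose_spec.2.2.choose_spec⟩

theorem IsChart.weylDist_one {A : Set (Finset (Σ i, V i))} {φ : W → ↥Δ.chambers}
    (hφ : Δ.IsChart A φ) (x : W) : Δ.weylDist (φ 1) (φ x) = x := by
  obtain ⟨A', ψ, hψ, h1, h2⟩ := exists_chart_weylDist (φ 1) (φ x)
  exact hψ.eq_of_eq hφ h1 h2

theorem IsChart.weylDist {A : Set (Finset (Σ i, V i))} {φ : W → ↥Δ.chambers}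
    (hφ : Δ.IsChart A φ) (x y : W) : Δ.weylDist (φ x) (φ y) = x⁻¹ * y := by
  simpa using (hφ.translate x).weylDist_one (x⁻¹ * y)

theorem weylDist_self (c : ↥Δ.chambers) : Δ.weylDist c c = 1 := by
  obtain ⟨A, φ, hφ, h1, -⟩ := Δ.exists_chart c c
  rw [← h1, hφ.weylDist, inv_mul_cancel]

theorem weylDist_eq_one_iff {c d : ↥Δ.chambers} : Δ.weylDist c d = 1 ↔ c = d := by
  constructor
  · intro h
    obtain ⟨A, φ, hφ, h1, h2⟩ := exists_chart_weylDist c d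
    rw [h, h1] at h2
    exact h2
  · rintro rfl
    exact weylDist_self c

theorem weylDist_inv (c d : ↥Δ.chambers) : (Δ.weylDist c d)⁻¹ = Δ.weylDist d c := by
  obtain ⟨A, φ, hφ, rfl, w, rfl⟩ := Δ.exists_chart c d
  simp [hφ.weylDist]

theorem exists_weylDist_eq (c : ↥Δ.chambers) (w : W) : ∃ d, Δ.weylDist c d = w := by
  obtain ⟨A, φ, hφ, rfl, -⟩ := Δ.exists_chart c c
  exact ⟨φ w, hφ.weylDist_one w⟩

theorem exists_adjacent_weylDist_eq (c d : ↥Δ.chambers) (i : I) :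
    ∃ e, Δ.Adjacent i d e ∧ Δ.weylDist c e = Δ.weylDist c d * cs.simple i := by
  obtain ⟨A, φ, hφ, rfl, w, rfl⟩ := Δ.exists_chart c d
  exact ⟨φ (w * cs.simple i), (hφ.adjacent _ _ _).2 (Or.inr rfl), by simp [hφ.weylDist]⟩

theorem Adjacent.weylDist_right {i : I} {d e : ↥Δ.chambers} (h : Δ.Adjacent i d e)
    (c : ↥Δ.chambers) :
    Δ.weylDist c e = Δ.weylDist c d ∨ Δ.weylDist c e = Δ.weylDist c d * cs.simple i := by
  obtain ⟨A, φ, hφ, h1, h2⟩ := exists_chart_weylDist c d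
  obtain ⟨A', ψ, hψ, h3, h4⟩ := exists_chart_weylDist c e
  rw [← h2, ← h4] at h
  exact hφ.eq_or_eq_of_adjacent hψ (h1.trans h3.symm) h

theorem Adjacent.weylDist_left {i : I} {c d : ↥Δ.chambers} (h : Δ.Adjacent i c d)
    (e : ↥Δ.chambers) :
    Δ.weylDist d e = Δ.weylDist c e ∨ Δ.weylDist d e = cs.simple i * Δ.weylDist c e := by
  rw [← weylDist_inv e d, ← weylDist_inv e c]
  rcases h.weylDist_right e with h | h <;> simp [h]

theorem Adjacent.weylDist_eq {i : I} {c d : ↥Δ.chambers} (h : Δ.Adjacent i c d) (hne : c ≠ d) :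
    Δ.weylDist c d = cs.simple i := by
  have h1 := h.weylDist_right c
  rw [weylDist_self, one_mul] at h1
  exact h1.resolve_left fun h2 => hne (weylDist_eq_one_iff.1 h2)

/-- Along a gallery of an apartment, the distance from an arbitrary chamber `e` changes by the
product of a subword of the type of the gallery; a minimal gallery from `x` to `x u` bounds the
length of this product by that of `u`. -/
theorem IsChart.exists_weylDist_mul_eq {A : Set (Finset (Σ i, V i))} {φ : W → ↥Δ.chambers}
    (hφ : Δ.IsChart A φ) (e : ↥Δ.chambers) (x u : W) :
    ∃ v, cs.length v ≤ cs.length u ∧ Δ.weylDist e (φ (x * u)) = Δ.weylDist e (φ x) * v := by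
  obtain ⟨ω, hω, rfl⟩ := cs.exists_isReduced u
  rw [hω.eq]
  clear hω
  induction ω using List.reverseRecOn with
  | nil => exact ⟨1, by simp, by simp⟩
  | append_singleton ω i ih =>
    obtain ⟨v, hv, h⟩ := ih
    have hadj : Δ.Adjacent i (φ (x * cs.wordProd ω)) (φ (x * cs.wordProd (ω ++ [i]))) :=
      (hφ.adjacent _ _ _).2 (Or.inr (by simp [cs.wordProd_append, mul_assoc]))
    rcases hadj.weylDist_right e with h1 | h1
    · exact ⟨v, by simp; omega, h1.trans h⟩
    · refine ⟨v * cs.simple i, ?_, by rw [h1, h, mul_assoc]⟩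
      have := cs.length_mul_le v (cs.simple i)
      rw [cs.length_simple] at this
      simp; omega

/-- If two charts that are based at the same chamber have `i`-adjacent chambers at `w`, where
`w` is shorter than `w s_i`, then they agree along every minimal gallery from `1` to `w`.
Otherwise, let `ψ (x s_k)` be the first chamber of the gallery of `ψ` outside the first
apartment. Seen from `φ (x s_k)` this gallery stammers in the step after `x`, and so the distance
to its last chamber is too small. -/
theorem IsChart.apply_wordProd_eq {A A' : Set (Finset (Σ i, V i))} {φ ψ : W → ↥Δ.chambers}
    (hφ : Δ.IsChart A φ) (hψ : Δ.IsChart A' ψ) (h1 : φ 1 = ψ 1) {w : W} {i : I}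
    (h : Δ.Adjacent i (φ w) (ψ w)) (ω : List I) :
    ∀ u, cs.wordProd ω * u = w →
      ω.length + cs.length u + 1 ≤ cs.length (w * cs.simple i) →
      φ (cs.wordProd ω) = ψ (cs.wordProd ω) := by
  induction ω using List.reverseRecOn with
  | nil => intro u _ _; simpa using h1
  | append_singleton ω k ih =>
    intro u hu hlen
    rw [cs.wordProd_append, cs.wordProd_singleton] at hu ⊢
    rw [List.length_append, List.length_singleton] at hlen
    set x := cs.wordProd ω
    have hxl : cs.length x ≤ ω.length := cs.length_wordProd_le ω
    have hku := cs.length_mul_le (cs.simple k) u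
    rw [cs.length_simple] at hku
    have hxx := ih (cs.simple k * u) (by rw [← hu, mul_assoc]) (by omega)
    by_contra hne
    have hadj : Δ.Adjacent k (φ (x * cs.simple k)) (ψ (x * cs.simple k)) := by
      have h2 := (hφ.adjacent x _ k).2 (Or.inr rfl)
      have h3 := (hψ.adjacent x _ k).2 (Or.inr rfl)
      rw [hxx] at h2
      exact h2.symm.trans h3
    obtain ⟨v, hv, h4⟩ := hψ.exists_weylDist_mul_eq (φ (x * cs.simple k)) (x * cs.simple k) u
    rw [hadj.weylDist_eq hne, hu] at h4
    have h5 := h.weylDist_right (φ (x * cs.simple k))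
    rw [h4, hφ.weylDist, ← hu, inv_mul_cancel_left] at h5
    have h6 : cs.length (w * cs.simple i) ≤
        cs.length x + cs.length (cs.simple k * u * cs.simple i) := by
      rw [← hu]
      simpa [mul_assoc] using cs.length_mul_le x (cs.simple k * u * cs.simple i)
    rcases h5 with h5 | h5
    · have h7 : cs.simple k * u = v := by rw [← h5]; simp
      rw [h7] at h6
      have h8 := cs.length_mul_le v (cs.simple i)
      rw [cs.length_simple] at h8
      omega
    · have h7 : cs.simple k * u * cs.simple i = v := by rw [mul_assoc, ← h5]; simp
      rw [h7] at h6
      omega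

/-- The distance from `c` grows from `d` to every other chamber of the `i`-panel of `d`, if
`δ(c, d) s_i` is longer than `δ(c, d)`. -/
theorem Adjacent.weylDist_eq_mul {i : I} {d e : ↥Δ.chambers} (h : Δ.Adjacent i d e) (hne : d ≠ e)
    {c : ↥Δ.chambers}
    (hlt : cs.length (Δ.weylDist c d) < cs.length (Δ.weylDist c d * cs.simple i)) :
    Δ.weylDist c e = Δ.weylDist c d * cs.simple i := by
  refine (h.weylDist_right c).resolve_left fun heq => hne ?_
  obtain ⟨A, φ, hφ, h1, h2⟩ := exists_chart_weylDist c d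
  obtain ⟨A', ψ, hψ, h3, h4⟩ := exists_chart_weylDist c e
  rw [heq] at h4
  rw [← h2, ← h4] at h
  obtain ⟨ω, hω, hw⟩ := cs.exists_isReduced (Δ.weylDist c d)
  have h5 := hφ.apply_wordProd_eq hψ (h1.trans h3.symm) h ω 1 (by rw [hw, mul_one])
    (by rw [cs.length_one, ← hω.eq, ← hw]; omega)
  rw [← hw, h2, h4] at h5
  exact h5

theorem Adjacent.weylDist_eq_mul_left {i : I} {c d : ↥Δ.chambers} (h : Δ.Adjacent i c d)
    (hne : c ≠ d) {e : ↥Δ.chambers}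
    (hlt : cs.length (Δ.weylDist c e) < cs.length (cs.simple i * Δ.weylDist c e)) :
    Δ.weylDist d e = cs.simple i * Δ.weylDist c e := by
  have h1 : cs.length (Δ.weylDist e c) < cs.length (Δ.weylDist e c * cs.simple i) := by
    rw [← weylDist_inv c e, cs.length_inv, ← cs.length_inv (_ * _)]
    simpa using hlt
  rw [← weylDist_inv e d, h.weylDist_eq_mul hne h1, ← weylDist_inv c e]
  simp

/-- The projection of `c` to a panel is unique. -/
theorem eq_of_weylDist_eq_mul {i : I} {c d e e' : ↥Δ.chambers} (h : Δ.Adjacent i e e')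
    (hlt : cs.length (Δ.weylDist c d * cs.simple i) < cs.length (Δ.weylDist c d))
    (he : Δ.weylDist c e = Δ.weylDist c d * cs.simple i)
    (he' : Δ.weylDist c e' = Δ.weylDist c d * cs.simple i) : e = e' := by
  by_contra hne
  have h1 := h.weylDist_eq_mul (c := c) hne (by rw [he]; simpa using hlt)
  rw [he', he] at h1
  have h2 : Δ.weylDist c d * cs.simple i = Δ.weylDist c d := by simpa using h1
  rw [h2] at hlt
  exact lt_irrefl _ hlt

theorem Gallery.exists_sublist {ω : List I} {c d : ↥Δ.chambers} (h : Δ.Gallery ω c d) :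
    ∃ ω', ω'.Sublist ω ∧ Δ.weylDist c d = cs.wordProd ω' := by
  induction h with
  | nil c => exact ⟨[], List.Sublist.slnil, by simp [weylDist_self]⟩
  | @cons i ω c d e hadj _ ih =>
    obtain ⟨ω', hω', h⟩ := ih
    rcases hadj.symm.weylDist_left e with h1 | h1
    · exact ⟨ω', hω'.cons i, h1.trans h⟩
    · exact ⟨i :: ω', hω'.cons_cons i, by rw [h1, h, cs.wordProd_cons]⟩

theorem IsChart.gallery {A : Set (Finset (Σ i, V i))} {φ : W → ↥Δ.chambers}
    (hφ : Δ.IsChart A φ) (ω : List I) : ∀ x, Δ.Gallery ω (φ x) (φ (x * cs.wordProd ω)) := by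
  induction ω with
  | nil => intro x; simpa using Gallery.nil (φ x)
  | cons i ω ih =>
    intro x
    refine Gallery.cons (d := φ (x * cs.simple i)) ((hφ.adjacent _ _ _).2 (Or.inr rfl)) ?_
    simpa [cs.wordProd_cons, mul_assoc] using ih (x * cs.simple i)

/-- The Weyl distance of the apartments is the one defined by minimal galleries. -/
theorem hasWeylDist_iff {c d : ↥Δ.chambers} {w : W} :
    Δ.HasWeylDist c d w ↔ Δ.weylDist c d = w := by
  obtain ⟨ω₀, hω₀, hw₀⟩ := cs.exists_isReduced (Δ.weylDist c d)
  have hg : Δ.Gallery ω₀ c d := by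
    obtain ⟨A, φ, hφ, h1, h2⟩ := exists_chart_weylDist c d
    have h3 := hφ.gallery ω₀ 1
    rwa [one_mul, ← hw₀, h1, h2] at h3
  constructor
  · rintro ⟨ω, hω, hmin, rfl⟩
    obtain ⟨ω', hsub, h⟩ := hω.exists_sublist
    have h1 := hmin ω₀ hg
    have h2 := cs.length_wordProd_le ω'
    rw [← h, hw₀, hω₀.eq] at h2
    rw [h, hsub.eq_of_length_le (h1.trans h2)]
  · rintro rfl
    refine ⟨ω₀, hg, fun ω' hω' => ?_, hw₀.symm⟩
    obtain ⟨ω'', hsub, h⟩ := hω'.exists_sublist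
    have h2 := cs.length_wordProd_le ω''
    rw [← h, hw₀, hω₀.eq] at h2
    exact h2.trans hsub.length_le

/-! ### The longest element -/

/-- The exchange condition, in the form of Tits's folding condition. It follows from thickness:
three chambers of a panel are seen at no more than two distances. -/
theorem length_simple_mul_mul_simple (Δ : ThickBuilding cs V) {w : W} {i j : I}
    (hi : cs.length w < cs.length (cs.simple i * w)) :
    cs.length (w * cs.simple j) < cs.length (cs.simple i * (w * cs.simple j)) ∨
      cs.simple i * w = w * cs.simple j := by
  by_contra! hcon
  obtain ⟨hlt, hne⟩ := hcon
  have hlt' : cs.length (cs.simple i * (w * cs.simple j)) < cs.length (w * cs.simple j) :=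
    lt_of_le_of_ne hlt (cs.length_simple_mul_ne _ _)
  obtain ⟨A, hA, -⟩ := Δ.exists_apartment ∅ Δ.empty_mem ∅ Δ.empty_mem
  obtain ⟨φ, hφ⟩ := exists_isChart hA
  have hcd : Δ.weylDist (φ 1) (φ w) = w := hφ.weylDist_one w
  have hcd' : Δ.weylDist (φ 1) (φ (w * cs.simple j)) = w * cs.simple j := hφ.weylDist_one _
  have hadj : Δ.Adjacent j (φ w) (φ (w * cs.simple j)) := (hφ.adjacent _ _ _).2 (Or.inr rfl)
  have hci : Δ.Adjacent i (φ 1) (φ (cs.simple i)) :=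
    (hφ.adjacent _ _ _).2 (Or.inr (one_mul _).symm)
  obtain ⟨e, hce, hec, hei⟩ := exists_third_chamber i (φ 1) (φ (cs.simple i))
  have h1 : Δ.weylDist e (φ w) = cs.simple i * w := by
    rw [hce.weylDist_eq_mul_left (Ne.symm hec) (by rwa [hcd]), hcd]
  have h2 : Δ.weylDist e (φ (w * cs.simple j)) = w * cs.simple j := by
    rcases hce.weylDist_left (φ (w * cs.simple j)) with h | h
    · rw [h, hcd']
    · exfalso
      rw [hcd'] at h
      have h3 : Δ.weylDist (φ (cs.simple i)) (φ (w * cs.simple j)) =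
          cs.simple i * (w * cs.simple j) := by simp [hφ.weylDist]
      have h4 := (hce.symm.trans hci).weylDist_eq_mul_left (e := φ (w * cs.simple j)) hei
        (by rw [h]; simpa using hlt')
      rw [h3, h] at h4
      rw [cs.simple_mul_simple_cancel_left] at h4
      rw [h4] at hlt'
      exact lt_irrefl _ hlt'
  rcases hadj.weylDist_right e with h | h
  · rw [h1, h2] at h
    exact hne h.symm
  · rw [h1, h2] at h
    have h3 : w = cs.simple i * w := by
      have : w * cs.simple j * cs.simple j = cs.simple i * w * cs.simple j * cs.simple j := by
        rw [← h]
      simpa using this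
    rw [← h3] at hi
    exact lt_irrefl _ hi

/-- The exchange condition for a reduced product `x z`: if left multiplication by a generator
lengthens `x` and shortens `x z`, then it amounts to shortening `z`. -/
theorem exists_mul_eq_of_descent (Δ : ThickBuilding cs V) {i : I} (ω : List I) :
    ∀ x : W, cs.length (x * cs.wordProd ω) = cs.length x + ω.length →
      cs.length x < cs.length (cs.simple i * x) →
      cs.length (cs.simple i * (x * cs.wordProd ω)) < cs.length (x * cs.wordProd ω) →
      ∃ z, cs.length z < ω.length ∧ cs.simple i * (x * cs.wordProd ω) = x * z := by
  induction ω with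
  | nil =>
    intro x _ h1 h2
    rw [cs.wordProd_nil, mul_one] at h2
    omega
  | cons j ω ih =>
    intro x hred h1 h2
    have h0 : x * cs.wordProd (j :: ω) = x * cs.simple j * cs.wordProd ω := by
      rw [cs.wordProd_cons, mul_assoc]
    rw [h0] at hred h2 ⊢
    rw [List.length_cons] at hred ⊢
    have h3 := cs.length_mul_le (x * cs.simple j) (cs.wordProd ω)
    have h4 := cs.length_wordProd_le ω
    have h5 := cs.length_mul_simple x j
    rcases Δ.length_simple_mul_mul_simple h1 (j := j) with h6 | h6
    · obtain ⟨z, hz, h7⟩ := ih (x * cs.simple j) (by omega) h6 h2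
      refine ⟨cs.simple j * z, ?_, by rw [h7, mul_assoc]⟩
      have := cs.length_mul_le (cs.simple j) z
      rw [cs.length_simple] at this
      omega
    · refine ⟨cs.wordProd ω, by omega, ?_⟩
      rw [mul_assoc x, ← mul_assoc, h6, ← mul_assoc, cs.simple_mul_simple_cancel_right]

/-- An element that is shortened by every generator has every reduced word as an initial segment of
a reduced expression. -/
theorem length_inv_mul_of_descents (Δ : ThickBuilding cs V) {v : W}
    (hv : ∀ i, cs.length (cs.simple i * v) < cs.length v) (ω : List I) (hω : cs.IsReduced ω) :
    ω.length + cs.length ((cs.wordProd ω)⁻¹ * v) = cs.length v := by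
  induction ω with
  | nil => simp
  | cons i ω ih =>
    have hω' : cs.IsReduced ω := by simpa using hω.drop 1
    have h1 := ih hω'
    obtain ⟨ω₁, hω₁, hw₁⟩ := cs.exists_isReduced ((cs.wordProd ω)⁻¹ * v)
    have hx : cs.wordProd ω * cs.wordProd ω₁ = v := by rw [← hw₁, mul_inv_cancel_left]
    rw [hw₁, hω₁.eq] at h1
    have h2 := hω.eq
    rw [cs.wordProd_cons, List.length_cons, ← hω'.eq] at h2
    obtain ⟨z, hz, h3⟩ := Δ.exists_mul_eq_of_descent (i := i) ω₁ (cs.wordProd ω)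
      (by rw [hx, hω'.eq]; omega) (by omega) (by rw [hx]; exact hv i)
    rw [hx] at h3
    have h4 : (cs.wordProd (i :: ω))⁻¹ * v = z := by
      rw [cs.wordProd_cons, mul_inv_rev, cs.inv_simple, mul_assoc, h3, inv_mul_cancel_left]
    have h5 := cs.length_mul_le (cs.wordProd (i :: ω)) z
    rw [← h4, mul_inv_cancel_left, h4] at h5
    rw [h4]
    have h6 := cs.length_wordProd_le (i :: ω)
    rw [List.length_cons] at h6 ⊢
    omega

theorem IsSpherical.finite (hΔ : Δ.IsSpherical) : Finite W := by
  obtain ⟨A, hA, -⟩ := Δ.exists_apartment ∅ Δ.empty_mem ∅ Δ.empty_mem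
  obtain ⟨φ, hφ⟩ := exists_isChart hA
  have := (hΔ A hA).to_subtype
  exact Finite.of_injective (fun w => (⟨_, hφ.mem w⟩ : ↥A)) fun w w' h =>
    hφ.inj (Subtype.ext (tupleVertices_injective (congrArg Subtype.val h)))

/-- Existence of the longest element. -/
theorem IsSpherical.exists_longest (hΔ : Δ.IsSpherical) :
    ∃ v : W, ∀ x, cs.length x + cs.length (x⁻¹ * v) = cs.length v := by
  have := hΔ.finite
  obtain ⟨v, hv⟩ := Finite.exists_max (fun w : W => cs.length w)
  refine ⟨v, fun x => ?_⟩
  obtain ⟨ω, hω, rfl⟩ := cs.exists_isReduced x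
  rw [hω.eq]
  exact Δ.length_inv_mul_of_descents
    (fun i => lt_of_le_of_ne (hv _) (cs.length_simple_mul_ne _ _)) ω hω

end

section

variable {I : Type*} {M : CoxeterMatrix I} {W : Type*} [Group W] {cs : CoxeterSystem M W}

theorem length_mul_of_longest {v : W}
    (hv : ∀ x, cs.length x + cs.length (x⁻¹ * v) = cs.length v) (w : W) :
    cs.length (v * w) + cs.length w = cs.length v := by
  have h := hv (v * w)
  rwa [mul_inv_rev, mul_assoc, inv_mul_cancel, mul_one, cs.length_inv] at h

/-- Conjugation by the longest element permutes the generators. -/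
theorem exists_simple_mul_eq_of_longest {v : W}
    (hv : ∀ x, cs.length x + cs.length (x⁻¹ * v) = cs.length v) (i : I) :
    ∃ j, cs.simple j * v = v * cs.simple i := by
  have h1 := hv (v * cs.simple i * v⁻¹)
  have h2 := length_mul_of_longest hv (cs.simple i)
  have h3 : (v * cs.simple i * v⁻¹)⁻¹ * v = v * cs.simple i := by simp [mul_assoc]
  rw [h3] at h1
  rw [cs.length_simple] at h2
  obtain ⟨j, hj⟩ := cs.length_eq_one_iff.1 (by omega : cs.length (v * cs.simple i * v⁻¹) = 1)
  exact ⟨j, by rw [← hj]; simp⟩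

end
section

variable {I : Type*} [Fintype I] {M : CoxeterMatrix I} {W : Type*} [Group W]
  {cs : CoxeterSystem M W} {V : I → Type*} {Δ : ThickBuilding cs V}

/-! ### Continuity of projections -/

theorem isClosed_setOf_adjacent [T : ∀ i, TopologicalSpace (V i)] (hT : Δ.IsCompactTopology T)
    (i : I) : IsClosed {p : ↥Δ.chambers × ↥Δ.chambers | Δ.Adjacent i p.1 p.2} := by
  have := hT.hausdorff
  simp only [adjacent_iff, Set.ofPred_forall]
  exact isClosed_iInter fun j => isClosed_iInter fun _ => isClosed_eq
    ((continuous_apply j).comp (continuous_subtype_val.comp continuous_fst))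
    ((continuous_apply j).comp (continuous_subtype_val.comp continuous_snd))

theorem IsCompactTopology.compactSpace_chambers [T : ∀ i, TopologicalSpace (V i)]
    (hT : Δ.IsCompactTopology T) : CompactSpace ↥Δ.chambers := by
  have := hT.compact
  exact isCompact_iff_compactSpace.1 hT.isClosed_chambers.isCompact

/-- The pairs of chambers at bounded distance form a closed set, by induction on the bound: the
pairs at distance at most `n + 1` are the images, under a projection along a compact space, of
pairs at distance at most `n` that are continued by a panel. -/
theorem isClosed_setOf_length_weylDist_le [T : ∀ i, TopologicalSpace (V i)]
    (hT : Δ.IsCompactTopology T) (n : ℕ) :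
    IsClosed {p : ↥Δ.chambers × ↥Δ.chambers | cs.length (Δ.weylDist p.1 p.2) ≤ n} := by
  have := hT.hausdorff
  have := hT.compactSpace_chambers
  induction n with
  | zero =>
    simp only [Nat.le_zero, cs.length_eq_zero_iff, weylDist_eq_one_iff]
    exact isClosed_eq continuous_fst continuous_snd
  | succ n ih =>
    have heq : {p : ↥Δ.chambers × ↥Δ.chambers | cs.length (Δ.weylDist p.1 p.2) ≤ n + 1} =
        {p : ↥Δ.chambers × ↥Δ.chambers | cs.length (Δ.weylDist p.1 p.2) ≤ n} ∪
        ⋃ i : I, Prod.fst '' {q : (↥Δ.chambers × ↥Δ.chambers) × ↥Δ.chambers |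
          Δ.Adjacent i q.2 q.1.2 ∧ cs.length (Δ.weylDist q.1.1 q.2) ≤ n} := by
      ext ⟨c, d⟩
      simp only [Set.mem_union, Set.mem_iUnion, Set.mem_image, Set.mem_ofPred_eq, Prod.exists,
        exists_and_right, exists_eq_right]
      constructor
      · intro h
        by_cases h1 : Δ.weylDist c d = 1
        · left; rw [h1, cs.length_one]; exact Nat.zero_le _
        · right
          obtain ⟨i, hi⟩ := cs.exists_rightDescent_of_ne_one h1
          obtain ⟨e, he, hce⟩ := exists_adjacent_weylDist_eq c d i
          refine ⟨i, e, he.symm, ?_⟩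
          have : cs.length (Δ.weylDist c d * cs.simple i) < cs.length (Δ.weylDist c d) := hi
          rw [hce]; omega
      · rintro (h | ⟨i, e, he, h⟩)
        · omega
        · rcases he.weylDist_right c with h1 | h1
          · rw [h1]; omega
          · have h2 := cs.length_mul_le (Δ.weylDist c e) (cs.simple i)
            rw [cs.length_simple] at h2
            rw [h1]; omega
    rw [heq]
    refine ih.union (isClosed_iUnion_of_finite fun i => isClosedMap_fst_of_compactSpace _ ?_)
    exact ((isClosed_setOf_adjacent hT i).preimage
      (f := fun q : (↥Δ.chambers × ↥Δ.chambers) × ↥Δ.chambers => (q.2, q.1.2))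
      (by fun_prop)).inter (ih.preimage
      (f := fun q : (↥Δ.chambers × ↥Δ.chambers) × ↥Δ.chambers => (q.1.1, q.2)) (by fun_prop))

/-- The projection of `a` to the `i`-panel of `b` depends continuously on `a` and `b`, as long as
their Weyl distance does not change: its graph is closed, and the set of chambers is compact. -/
theorem IsCompactTopology.continuous_projection [T : ∀ i, TopologicalSpace (V i)]
    (hT : Δ.IsCompactTopology T) {X : Type*} [TopologicalSpace X] {a b p : X → ↥Δ.chambers}
    (ha : Continuous a) (hb : Continuous b) {v : W} {i : I}
    (hv : cs.length (v * cs.simple i) < cs.length v)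
    (hab : ∀ x, Δ.weylDist (a x) (b x) = v) (hbp : ∀ x, Δ.Adjacent i (b x) (p x))
    (hap : ∀ x, Δ.weylDist (a x) (p x) = v * cs.simple i) : Continuous p := by
  have := hT.compactSpace_chambers
  have hgraph : IsClosed {q : X × ↥Δ.chambers | p q.1 = q.2} := by
    have heq : {q : X × ↥Δ.chambers | p q.1 = q.2} =
        {q | Δ.Adjacent i (b q.1) q.2} ∩
        {q | cs.length (Δ.weylDist (a q.1) q.2) ≤ cs.length (v * cs.simple i)} := by
      ext ⟨x, c⟩
      simp only [Set.mem_inter_iff, Set.mem_ofPred_eq]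
      constructor
      · rintro rfl
        exact ⟨hbp x, by rw [hap]⟩
      · rintro ⟨h1, h2⟩
        refine eq_of_weylDist_eq_mul (c := a x) (d := b x) ((hbp x).symm.trans h1)
          (by rwa [hab]) (by rw [hap, hab]) ?_
        refine (h1.weylDist_right (a x)).resolve_left fun h3 => ?_
        rw [h3, hab] at h2
        omega
    rw [heq]
    exact ((isClosed_setOf_adjacent hT i).preimage
      (f := fun q : X × ↥Δ.chambers => (b q.1, q.2)) (by fun_prop)).inter
      ((isClosed_setOf_length_weylDist_le hT _).preimage
      (f := fun q : X × ↥Δ.chambers => (a q.1, q.2)) (by fun_prop))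
  rw [continuous_iff_isClosed]
  intro F hF
  have heq : p ⁻¹' F = Prod.fst '' ({q : X × ↥Δ.chambers | p q.1 = q.2} ∩ Prod.snd ⁻¹' F) := by
    ext x
    simp
  rw [heq]
  exact isClosedMap_fst_of_compactSpace _ (hgraph.inter (hF.preimage continuous_snd))

/-! ### Schubert cells -/

theorem weylDist_eq_mul_of_length {a b c : ↥Δ.chambers}
    (h : cs.length (Δ.weylDist a b * Δ.weylDist b c) =
      cs.length (Δ.weylDist a b) + cs.length (Δ.weylDist b c)) :
    Δ.weylDist a c = Δ.weylDist a b * Δ.weylDist b c := by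
  obtain ⟨A, φ, hφ, h1, h2⟩ := exists_chart_weylDist b c
  obtain ⟨ω, hω, hw⟩ := cs.exists_isReduced (Δ.weylDist b c)
  have key : ∀ ω : List I,
      cs.length (Δ.weylDist a b * cs.wordProd ω) = cs.length (Δ.weylDist a b) + ω.length →
      Δ.weylDist a (φ (cs.wordProd ω)) = Δ.weylDist a b * cs.wordProd ω := by
    intro ω
    induction ω using List.reverseRecOn with
    | nil => intro _; simp [h1]
    | append_singleton ω i ih =>
      intro hlen
      rw [cs.wordProd_append, cs.wordProd_singleton, ← mul_assoc, List.length_append,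
        List.length_singleton] at hlen
      have h3 := cs.length_mul_le (Δ.weylDist a b * cs.wordProd ω) (cs.simple i)
      have h4 := cs.length_mul_le (Δ.weylDist a b) (cs.wordProd ω)
      have h5 := cs.length_wordProd_le ω
      rw [cs.length_simple] at h3
      have h6 := ih (by omega)
      have hadj : Δ.Adjacent i (φ (cs.wordProd ω)) (φ (cs.wordProd (ω ++ [i]))) :=
        (hφ.adjacent _ _ _).2 (Or.inr (by simp [cs.wordProd_append]))
      rw [hadj.weylDist_eq_mul (c := a) ?_ (by rw [h6]; omega), h6]
      · simp [cs.wordProd_append, mul_assoc]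
      · intro h7
        have h8 := hφ.inj h7
        rw [cs.wordProd_append, cs.wordProd_singleton] at h8
        rw [mul_assoc, ← h8] at hlen
        omega
  rw [hw, hω.eq] at h
  have h9 := key ω h
  rwa [← hw, h2] at h9

/-- Let `w = u s_i` be longer than `u`. There is a panel `P` with a chamber `e` such that
`C_w(c₀)` is the product of `P \ {e}` and `C_u(c₀)`. The chamber `e` is chosen so that all
chambers of `C_w(c₀)` are opposite to it; then `P` is opposite to the `i`-panel of every chamber
of `C_u(c₀)`, so that the projections identify all these panels with `P`. -/
theorem IsSpherical.exists_schubertCell_mul_simple_equiv (hΔ : Δ.IsSpherical)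
    (c₀ : ↥Δ.chambers) {u : W} {i : I} (hu : cs.length u < cs.length (u * cs.simple i)) :
    ∃ (j : I) (e : ↥Δ.chambers)
      (f : ↥(Δ.schubertCell c₀ (u * cs.simple i)) ≃
        ↥({d | Δ.Adjacent j e d} \ {e}) × ↥(Δ.schubertCell c₀ u)),
      ∀ [T : ∀ i, TopologicalSpace (V i)], Δ.IsCompactTopology T →
        Continuous f ∧ Continuous f.symm := by
  obtain ⟨v, hv⟩ := hΔ.exists_longest
  obtain ⟨j, hj⟩ := exists_simple_mul_eq_of_longest hv i
  have lenu := cs.length_mul_simple u i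
  have lenv : ∀ w, cs.length (v * w) + cs.length w = cs.length v := length_mul_of_longest hv
  obtain ⟨e, he⟩ := exists_weylDist_eq c₀ (v * (u * cs.simple i)⁻¹)⁻¹
  have he0 : Δ.weylDist e c₀ = v * (u * cs.simple i)⁻¹ := by rw [← weylDist_inv, he, inv_inv]
  have lenvs : cs.length (v * cs.simple i) < cs.length v := by
    have := lenv (cs.simple i)
    rw [cs.length_simple] at this; omega
  have lenvi : cs.length (v⁻¹ * cs.simple j) < cs.length v⁻¹ := by
    rw [← cs.length_inv (_ * _), mul_inv_rev, inv_inv, cs.inv_simple, hj, cs.length_inv]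
    exact lenvs
  have lene := lenv (u * cs.simple i)⁻¹
  rw [cs.length_inv] at lene
  -- chambers of the two cells, seen from `e`
  have distw : ∀ c, Δ.weylDist c₀ c = u * cs.simple i → Δ.weylDist e c = v := by
    intro c hc
    have := weylDist_eq_mul_of_length (Δ := Δ) (a := e) (b := c₀) (c := c)
      (by rw [he0, hc, inv_mul_cancel_right]; omega)
    rw [this, he0, hc, inv_mul_cancel_right]
  have distu : ∀ c, Δ.weylDist c₀ c = u → Δ.weylDist e c = v * cs.simple i := by
    intro c hc
    have h1 : v * (u * cs.simple i)⁻¹ * u = v * cs.simple i := by simp [mul_assoc]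
    have h2 := lenv (cs.simple i)
    rw [cs.length_simple] at h2
    have := weylDist_eq_mul_of_length (Δ := Δ) (a := e) (b := c₀) (c := c)
      (by rw [he0, hc, h1]; omega)
    rw [this, he0, hc, h1]
  have distP : ∀ x c, Δ.Adjacent j e x → x ≠ e → Δ.weylDist c₀ c = u → Δ.weylDist x c = v := by
    intro x c hx hne hc
    have h1 : cs.simple j * (v * cs.simple i) = v := by rw [← hj]; simp
    rw [hx.weylDist_eq_mul_left (e := c) hne.symm (by rw [distu c hc, h1]; exact lenvs),
      distu c hc, h1]
  have hwu : ∀ c : ↥(Δ.schubertCell c₀ (u * cs.simple i)),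
      Δ.weylDist c₀ c.1 = u * cs.simple i := fun c => hasWeylDist_iff.1 c.2
  have huu : ∀ c : ↥(Δ.schubertCell c₀ u), Δ.weylDist c₀ c.1 = u :=
    fun c => hasWeylDist_iff.1 c.2
  -- the projections of `c₀` to the `i`-panel of `c`, and of `c` to the `j`-panel of `e`
  choose p hp hp' using fun c : ↥(Δ.schubertCell c₀ (u * cs.simple i)) =>
    exists_adjacent_weylDist_eq c₀ c.1 i
  choose q hq hq' using fun c : ↥(Δ.schubertCell c₀ (u * cs.simple i)) =>
    exists_adjacent_weylDist_eq c.1 e j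
  have hce : ∀ c : ↥(Δ.schubertCell c₀ (u * cs.simple i)), Δ.weylDist c.1 e = v⁻¹ :=
    fun c => by rw [← weylDist_inv, distw _ (hwu c)]
  have hqe : ∀ c, q c ≠ e := by
    intro c h
    have h1 := hq' c
    rw [h, hce] at h1
    rw [← h1] at lenvi
    exact lt_irrefl _ lenvi
  have hpu : ∀ c, Δ.weylDist c₀ (p c) = u := fun c => by rw [hp', hwu]; simp
  -- the projection of `x` to the `i`-panel of `c`
  choose r hr hr' using fun y : ↥({d | Δ.Adjacent j e d} \ {e}) × ↥(Δ.schubertCell c₀ u) =>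
    exists_adjacent_weylDist_eq y.1.1 y.2.1 i
  have hxy : ∀ y : ↥({d | Δ.Adjacent j e d} \ {e}) × ↥(Δ.schubertCell c₀ u),
      Δ.weylDist y.1.1 y.2.1 = v := fun y => distP _ _ y.1.2.1 y.1.2.2 (huu y.2)
  have hrw : ∀ y, Δ.weylDist c₀ (r y) = u * cs.simple i := by
    intro y
    have hne : y.2.1 ≠ r y := by
      intro h
      have h1 := hr' y
      rw [← h, hxy] at h1
      rw [← h1] at lenvs
      exact lt_irrefl _ lenvs
    rw [(hr y).weylDist_eq_mul hne (by rwa [huu]), huu]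
  let f : ↥(Δ.schubertCell c₀ (u * cs.simple i)) ≃
      ↥({d | Δ.Adjacent j e d} \ {e}) × ↥(Δ.schubertCell c₀ u) :=
    { toFun := fun c => (⟨q c, hq c, hqe c⟩, ⟨p c, hasWeylDist_iff.2 (hpu c)⟩)
      invFun := fun y => ⟨r y, hasWeylDist_iff.2 (hrw y)⟩
      left_inv := by
        intro c
        apply Subtype.ext
        have hqp : Δ.weylDist (q c) (p c) = v := distP _ _ (hq c) (hqe c) (hpu c)
        refine eq_of_weylDist_eq_mul (i := i) (c := q c) (d := p c)
          ((hr _).symm.trans (hp c).symm) (by rwa [hqp])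
          (hr' (⟨q c, hq c, hqe c⟩, ⟨p c, hasWeylDist_iff.2 (hpu c)⟩)) ?_
        rw [← weylDist_inv, hq', hce, hqp, mul_inv_rev, inv_inv, cs.inv_simple, hj]
      right_inv := by
        intro y
        refine Prod.ext (Subtype.ext ?_) (Subtype.ext ?_)
        · refine eq_of_weylDist_eq_mul (i := j) (c := r y) (d := e)
            ((hq _).symm.trans y.1.2.1) ?_
            (hq' ⟨r y, hasWeylDist_iff.2 (hrw y)⟩) ?_
          · rw [hce ⟨r y, hasWeylDist_iff.2 (hrw y)⟩]; exact lenvi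
          · rw [hce ⟨r y, hasWeylDist_iff.2 (hrw y)⟩, ← weylDist_inv, hr', hxy, ← hj,
              mul_inv_rev, cs.inv_simple]
        · refine eq_of_weylDist_eq_mul (i := i) (c := c₀) (d := r y)
            ((hp _).symm.trans (hr y).symm) (by rw [hrw]; simpa using hu) (hp' _) ?_
          rw [huu, hrw]; simp }
  refine ⟨j, e, f, fun {T} hT => ⟨?_, ?_⟩⟩
  · have hcq : Continuous q := hT.continuous_projection continuous_subtype_val continuous_const
      lenvi hce hq (fun c => by rw [hq', hce])
    have hcp : Continuous p := hT.continuous_projection continuous_const continuous_subtype_val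
      (v := u * cs.simple i) (by simpa using hu) hwu hp (fun c => by rw [hp', hwu])
    exact (hcq.subtype_mk _).prodMk (hcp.subtype_mk _)
  · have hcr : Continuous r := hT.continuous_projection
      (continuous_subtype_val.comp continuous_fst) (continuous_subtype_val.comp continuous_snd)
      lenvs hxy hr (fun y => (hr' y).trans (by rw [hxy]))
    exact hcr.subtype_mk _

/-- A Schubert cell is a product of punctured panels, by a bijection that does not depend on the
topology and that is a homeomorphism for every compact topology. -/
theorem IsSpherical.exists_schubertCell_equiv (hΔ : Δ.IsSpherical) (c₀ : ↥Δ.chambers) (m : ℕ) :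
    ∀ w : W, cs.length w = m →
      ∃ (P : Fin m → Set ↥Δ.chambers) (d : Fin m → ↥Δ.chambers),
        (∀ k, Δ.IsPanel (P k) ∧ d k ∈ P k) ∧
        ∃ f : ↥(Δ.schubertCell c₀ w) ≃ (∀ k, ↥(P k \ {d k})),
          ∀ [T : ∀ i, TopologicalSpace (V i)], Δ.IsCompactTopology T →
            Continuous f ∧ Continuous f.symm := by
  induction m with
  | zero =>
    intro w hw
    obtain rfl := cs.length_eq_zero_iff.1 hw
    have hsub : ∀ c : ↥(Δ.schubertCell c₀ 1), c = ⟨c₀, hasWeylDist_iff.2 (weylDist_self c₀)⟩ :=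
      fun c => Subtype.ext (weylDist_eq_one_iff.1 (hasWeylDist_iff.1 c.2)).symm
    refine ⟨Fin.elim0, Fin.elim0, fun k => k.elim0,
      { toFun := fun _ k => k.elim0
        invFun := fun _ => ⟨c₀, hasWeylDist_iff.2 (weylDist_self c₀)⟩
        left_inv := fun c => (hsub c).symm
        right_inv := fun _ => funext fun k => k.elim0 }, fun {T} _ => ⟨?_, ?_⟩⟩
    · exact continuous_const
    · exact continuous_const
  | succ m ih =>
    intro w hw
    have hne : w ≠ 1 := by
      rintro rfl
      rw [cs.length_one] at hw
      omega
    obtain ⟨i, hi⟩ := cs.exists_rightDescent_of_ne_one hne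
    have hi' : cs.length (w * cs.simple i) + 1 = cs.length w := cs.isRightDescent_iff.1 hi
    obtain ⟨u, rfl⟩ : ∃ u, w = u * cs.simple i := ⟨w * cs.simple i, by simp⟩
    rw [cs.simple_mul_simple_cancel_right] at hi'
    obtain ⟨P, d, hP, f, hf⟩ := ih u (by omega)
    obtain ⟨j, e, g, hg⟩ := hΔ.exists_schubertCell_mul_simple_equiv c₀ (u := u) (i := i)
      (by omega)
    let P' : Fin (m + 1) → Set ↥Δ.chambers := Fin.cons {d | Δ.Adjacent j e d} P
    let d' : Fin (m + 1) → ↥Δ.chambers := Fin.cons e d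
    refine ⟨P', d', Fin.cases ⟨isPanel_setOf_adjacent j e, Adjacent.refl j e⟩ hP,
      (g.trans ((Equiv.refl _).prodCongr f)).trans (Fin.consEquiv fun k => ↥(P' k \ {d' k})),
      fun {T} hT => ⟨?_, ?_⟩⟩
    · obtain ⟨hg1, -⟩ := hg hT
      obtain ⟨hf1, -⟩ := hf hT
      refine continuous_pi (Fin.cases ?_ fun k => ?_)
      · have h1 : Continuous fun c => (g c).1 := continuous_fst.comp hg1
        exact h1
      · have h1 : Continuous fun c => f (g c).2 k :=
          (continuous_apply k).comp (hf1.comp (continuous_snd.comp hg1))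
        exact h1
    · obtain ⟨-, hg2⟩ := hg hT
      obtain ⟨-, hf2⟩ := hf hT
      refine hg2.comp ((continuous_apply (0 : Fin (m + 1))).prodMk (hf2.comp ?_))
      exact continuous_pi fun k => continuous_apply (Fin.succ k)

/-! ### Uniqueness of the topology -/

open scoped Topology

/-- The big cells are open: a chamber is in the big cell of `c₀` if and only if it is not at
smaller distance. -/
theorem IsCompactTopology.isOpen_schubertCell [T : ∀ i, TopologicalSpace (V i)]
    (hT : Δ.IsCompactTopology T) {v : W}
    (hv : ∀ x, cs.length x + cs.length (x⁻¹ * v) = cs.length v) (c₀ : ↥Δ.chambers) :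
    IsOpen (Δ.schubertCell c₀ v) := by
  have heq : (Δ.schubertCell c₀ v)ᶜ = {c | cs.length (Δ.weylDist c₀ c) < cs.length v} := by
    ext c
    have h1 := hv (Δ.weylDist c₀ c)
    have h2 : cs.length ((Δ.weylDist c₀ c)⁻¹ * v) = 0 ↔ Δ.weylDist c₀ c = v := by
      rw [cs.length_eq_zero_iff, inv_mul_eq_one]
    have h3 : c ∈ (Δ.schubertCell c₀ v)ᶜ ↔ ¬ Δ.weylDist c₀ c = v := not_congr hasWeylDist_iff
    rw [h3, ← h2, Set.mem_ofPred_eq]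
    omega
  rw [← isClosed_compl_iff, heq]
  generalize cs.length v = n
  cases n with
  | zero => simp
  | succ n =>
    simp only [Nat.lt_succ_iff]
    exact (isClosed_setOf_length_weylDist_le hT n).preimage
      (f := fun c : ↥Δ.chambers => (c₀, c)) (by fun_prop)

/-- Two topologies agree if they agree on a cover by sets that are open for both. -/
theorem _root_.TopologicalSpace.eq_of_induced_eq {X : Type*} {t t' : TopologicalSpace X}
    (h : ∀ x, ∃ B : Set X, x ∈ B ∧ IsOpen[t] B ∧ IsOpen[t'] B ∧
      t.induced (Subtype.val : ↥B → X) = t'.induced Subtype.val) : t = t' := by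
  have key : ∀ t t' : TopologicalSpace X, (∀ x, ∃ B : Set X, x ∈ B ∧ IsOpen[t] B ∧ IsOpen[t'] B ∧
      t.induced (Subtype.val : ↥B → X) = t'.induced Subtype.val) → t ≤ t' := by
    intro t t' h U hU
    rw [@isOpen_iff_forall_mem_open X t U]
    intro x hx
    obtain ⟨B, hxB, hB, -, heq⟩ := h x
    have h1 : IsOpen[t'.induced (Subtype.val : ↥B → X)] (Subtype.val ⁻¹' U) := ⟨U, hU, rfl⟩
    rw [← heq] at h1
    obtain ⟨U', hU', h2⟩ := h1
    refine ⟨U' ∩ B, ?_, @IsOpen.inter X t _ _ hU' hB, ?_, hxB⟩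
    · rintro y ⟨hy, hyB⟩
      exact (Set.ext_iff.1 h2 ⟨y, hyB⟩).1 hy
    · exact (Set.ext_iff.1 h2 ⟨x, hxB⟩).2 hx
  refine le_antisymm (key t t' h) (key t' t fun x => ?_)
  obtain ⟨B, h1, h2, h3, h4⟩ := h x
  exact ⟨B, h1, h3, h2, h4.symm⟩

theorem setTopology_eq_of_subset {T T' : ∀ i, TopologicalSpace (V i)} {P Q : Set ↥Δ.chambers}
    (hQ : Q ⊆ P) (h : Δ.setTopology T P = Δ.setTopology T' P) :
    Δ.setTopology T Q = Δ.setTopology T' Q := by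
  have key : ∀ T : ∀ i, TopologicalSpace (V i),
      Δ.setTopology T Q = (Δ.setTopology T P).induced (Set.inclusion hQ) := by
    intro T
    rw [induced_compose]
    rfl
  rw [key, key, h]

theorem IsSpherical.chamberTopology_eq (hΔ : Δ.IsSpherical) {T T' : ∀ i, TopologicalSpace (V i)}
    (hT : Δ.IsCompactTopology T) (hT' : Δ.IsCompactTopology T')
    (h : ∀ P : Set ↥Δ.chambers, Δ.IsPanel P → Δ.setTopology T P = Δ.setTopology T' P) :
    Δ.chamberTopology T = Δ.chamberTopology T' := by
  obtain ⟨v, hv⟩ := hΔ.exists_longest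
  refine TopologicalSpace.eq_of_induced_eq fun c => ?_
  obtain ⟨c₀, hc₀⟩ := exists_weylDist_eq c v⁻¹
  refine ⟨Δ.schubertCell c₀ v, ?_, hT.isOpen_schubertCell (T := T) hv c₀,
    hT'.isOpen_schubertCell (T := T') hv c₀, ?_⟩
  · exact hasWeylDist_iff.2 (by rw [← weylDist_inv, hc₀, inv_inv])
  · obtain ⟨P, d, hP, f, hf⟩ := hΔ.exists_schubertCell_equiv c₀ _ v rfl
    have key : ∀ T : ∀ i, TopologicalSpace (V i), Δ.IsCompactTopology T →
        Δ.setTopology T (Δ.schubertCell c₀ v) =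
          (@Pi.topologicalSpace _ (fun k => ↥(P k \ {d k}))
            fun k => Δ.setTopology T (P k \ {d k})).induced f := by
      intro T hT
      obtain ⟨h1, h2⟩ := hf hT
      exact (Homeomorph.mk f h1 h2).isInducing.eq_induced
    have hpi : (fun k => Δ.setTopology T (P k \ {d k})) =
        fun k => Δ.setTopology T' (P k \ {d k}) :=
      funext fun k => setTopology_eq_of_subset Set.sdiff_subset (h _ (hP k).1)
    exact (key T hT).trans ((by rw [hpi] : _ = _).trans (key T' hT').symm)

theorem exists_chamber_apply_eq (Δ : ThickBuilding cs V) {i : I} (x : V i) :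
    ∃ c : ↥Δ.chambers, c.1 i = x := by
  obtain ⟨A, hA, hx, -⟩ := Δ.exists_apartment _ (Δ.singleton_mem ⟨i, x⟩) ∅ Δ.empty_mem
  obtain ⟨φ, hφ⟩ := exists_isChart hA
  obtain ⟨w, hw⟩ := hφ.exists_ge _ hx
  exact ⟨φ w, mem_tupleVertices.1 (hw (Finset.mem_singleton_self _))⟩

/-- The set of vertices of type `i` carries the quotient topology from the set of chambers. -/
theorem IsCompactTopology.eq_coinduced {T : ∀ i, TopologicalSpace (V i)}
    (hT : Δ.IsCompactTopology T) (i : I) :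
    T i = (Δ.chamberTopology T).coinduced fun c => c.1 i := by
  have := hT.compactSpace_chambers
  have := hT.hausdorff
  have hc : Continuous fun c : ↥Δ.chambers => c.1 i :=
    (continuous_apply i).comp continuous_subtype_val
  exact (Topology.IsQuotientMap.of_surjective_continuous
    (fun x => Δ.exists_chamber_apply_eq x) hc).eq_coinduced

end
end ThickBuilding

theorem mainTheorem7 {I : Type*} [Fintype I] {M : CoxeterMatrix I} {W : Type*} [Group W]
    (cs : CoxeterSystem M W) {V : I → Type*} (Δ : ThickBuilding cs V) (hΔ : Δ.IsSpherical) :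
    (∀ T : ∀ i, TopologicalSpace (V i), Δ.IsCompactTopology T →
      ∀ (c₀ : ↥Δ.chambers) (w : W) (m : ℕ), cs.length w = m → 1 ≤ m →
        ∃ (P : Fin m → Set ↥Δ.chambers) (d : Fin m → ↥Δ.chambers),
          (∀ k, Δ.IsPanel (P k) ∧ d k ∈ P k) ∧
          Nonempty (@Homeomorph (↥(Δ.schubertCell c₀ w)) (∀ k, ↥(P k \ {d k}))
            (Δ.setTopology T (Δ.schubertCell c₀ w))
            (@Pi.topologicalSpace (Fin m) (fun k => ↥(P k \ {d k}))
              (fun k => Δ.setTopology T (P k \ {d k}))))) ∧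
    (∀ T T' : ∀ i, TopologicalSpace (V i), Δ.IsCompactTopology T → Δ.IsCompactTopology T' →
      (∀ P : Set ↥Δ.chambers, Δ.IsPanel P → Δ.setTopology T P = Δ.setTopology T' P) →
        ∀ i, T i = T' i) := by
  refine ⟨fun T hT c₀ w m hw _ => ?_, fun T T' hT hT' h i => ?_⟩
  · obtain ⟨P, d, hP, f, hf⟩ := hΔ.exists_schubertCell_equiv c₀ m w hw
    obtain ⟨h1, h2⟩ := hf hT
    exact ⟨P, d, hP, ⟨Homeomorph.mk f h1 h2⟩⟩
  · rw [hT.eq_coinduced i, hT'.eq_coinduced i, hΔ.chamberTopology_eq hT hT' h]
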